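/- **Setting.** Let $\Omega\subset\mathbb R^N$ be a bounded open set (for instance a bounded smooth domain), let $1\le p\le\infty$, and let $q$ be the conjugate exponent of $p$. Let $J:\mathbb R^N\times\mathbb R^N\to[0,\infty)$ be measurable and symmetric with $\int_{\mathbb R^N}J(x,y)\,dy=1$ for all $x$. Assume that $\sup_{x\in\Omega}\|J(x,\cdot)\|_{L^q(\Omega)}<\infty$, that $x\mapsto J(x,y)$ is differentiable on $\Omega$ for every $y\in\Omega$, and that $\sup_{x\in\Omega}\|\partial_xJ(x,\cdot)\|_{L^q(\Omega)}<\infty$. For $u$ in $X=L^p(\Omega)$ (functions on $\mathbb R^N$ that vanish outside $\Omega$) put $Ku(x)=\int_\Omega J(x,y)u(y)\,dy$. Let $g:\mathbb R\times\mathbb R\to\mathbb R$ be continuously differentiable, and assume that there are constants $k_1<1$ and $k_2$ with $|g(t,x)|\le k_2+k_1|x|$ for all $t,x\in\mathbb R$, and that for every $r$ the derivative $\partial_2g(t,x)$ with respect to the second variable is bounded on $\{|x|\le r\}$ uniformly in $t\in\mathbb R$. Let $S(t,\tau)$, $t\ge\tau$, be the process on $X$ generated by $$\partial_tu(t,x)=-u(t,x)+g\big(t,Ku(t,\cdot)(x)\big)\quad(x\in\Omega,\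 t\ge\tau),\qquad u(\tau,\cdot)=u_\tau ,$$ that is, $S(t,\tau)u_\tau=u(t)$, where $u:[\tau,\infty)\to X$ is the continuous, everywhere differentiable solution of this Cauchy problem in $X$. Let $\{\mathcal A(t)\}_{t\in\mathbb R}$ be the pullback attractor of $S$ in $X$: each $\mathcal A(t)$ is compact; $S(t,\tau)\mathcal A(\tau)=\mathcal A(t)$ for $\tau\le t$; for every bounded $C\subset X$ and every $t$ one has $\sup_{a\in S(t,\tau)C}\inf_{b\in\mathcal A(t)}\|a-b\|_X\to0$ as $\tau\to-\infty$; and $\mathcal A(t)\subset C(t)$ for all $t$, for every family of closed sets $\{C(t)\}_{t\in\mathbb R}$ with this attraction property. **Theorem.** There is a bounded subset $B$ of $W^{1,p}(\Omega)$ such that $\mathcal A(t)\subset B$ for every $t\in\mathbb R$. -/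

import Mathlib

open MeasureTheory Filter Topology Set
open scoped ENNReal ContDiff

noncomputable section

namespace NonlocalEvolution

/-- The space `ℝ^N` with its Euclidean norm. -/
abbrev E (N : ℕ) : Type := EuclideanSpace ℝ (Fin N)

/-- The phase space `L^p(Ω)`, identified with the space of functions in `L^p(ℝ^N)`
that vanish outside `Ω`. -/
abbrev X {N : ℕ} (Ω : Set (E N)) (p : ℝ≥0∞) : Type :=
  Lp ℝ p ((volume : Measure (E N)).restrict Ω)

/-- The integral operator `K u (x) = ∫ J(x,y) u(y) dy`, for `u` vanishing outside `Ω`. -/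
def K {N : ℕ} (Ω : Set (E N)) (J : E N → E N → ℝ) (u : E N → ℝ) (x : E N) : ℝ :=
  ∫ y in Ω, J x y * u y

/-- `u` solves `∂ₜ u = -u + g(t, K u)` in `L^p(Ω)` on `[τ, ∞)`, with `u(τ) = u₀`:
it is continuous on `[τ, ∞)`, and at every `t ≥ τ` it has a derivative in `L^p(Ω)`
(a right derivative if `t = τ`) that agrees with the right-hand side. -/
structure IsSolution {N : ℕ} (Ω : Set (E N)) (p : ℝ≥0∞) [Fact (1 ≤ p)]
    (J : E N → E N → ℝ) (g : ℝ → ℝ → ℝ) (τ : ℝ) (u₀ : X Ω p) (u : ℝ → X Ω p) : Prop where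
  continuousOn : ContinuousOn u (Ici τ)
  initial : u τ = u₀
  equation : ∀ t, τ ≤ t → ∃ u' : X Ω p, HasDerivWithinAt u u' (Ici τ) t ∧
    ∀ᵐ x ∂((volume : Measure (E N)).restrict Ω), u' x = -(u t x) + g t (K Ω J (u t) x)

open Classical in
/-- The process generated by the equation: `process Ω p J g t τ u₀`, for `t ≥ τ`, is the value at
time `t` of the solution that starts from `u₀` at time `τ`. (Under the standing assumptions this
solution exists and is unique, so the value `0` in the `else` branch is never taken.) -/
def process {N : ℕ} (Ω : Set (E N)) (p : ℝ≥0∞) [Fact (1 ≤ p)]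
    (J : E N → E N → ℝ) (g : ℝ → ℝ → ℝ) (t τ : ℝ) (u₀ : X Ω p) : X Ω p :=
  if h : ∃ u : ℝ → X Ω p, IsSolution Ω p J g τ u₀ u then h.choose t else 0

section Attractor

variable {Y : Type*} [PseudoMetricSpace Y]

/-- Hausdorff semi-distance `sup_{a ∈ A} inf_{b ∈ B} d(a, b)`. -/
def semiDist (A B : Set Y) : ℝ≥0∞ := ⨆ a ∈ A, Metric.infEDist a B

/-- The family `C` pullback attracts the bounded subsets of `Y` under `S`. -/
def PullbackAttracts (S : ℝ → ℝ → Y → Y) (C : ℝ → Set Y) : Prop :=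
  ∀ t : ℝ, ∀ B : Set Y, Bornology.IsBounded B →
    Tendsto (fun τ : ℝ => semiDist (S t τ '' B) (C t)) atBot (𝓝 0)

/-- Pullback attractor of the process `S`, where `S t τ` (for `τ ≤ t`) maps states at time `τ` to
states at time `t`. -/
structure IsPullbackAttractor (S : ℝ → ℝ → Y → Y) (A : ℝ → Set Y) : Prop where
  compact : ∀ t, IsCompact (A t)
  invariant : ∀ τ t, τ ≤ t → S t τ '' A τ = A t
  attracts : PullbackAttracts S A
  minimal : ∀ C : ℝ → Set Y, (∀ t, IsClosed (C t)) → PullbackAttracts S C → ∀ t, A t ⊆ C t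

end Attractor

/-- `v` is the weak partial derivative `∂ᵢ u` on `Ω`, tested with `C_c^∞(Ω)`. -/
def IsWeakPartialDeriv {N : ℕ} (Ω : Set (E N)) (i : Fin N) (u v : E N → ℝ) : Prop :=
  ∀ φ : E N → ℝ, ContDiff ℝ ∞ φ → HasCompactSupport φ → tsupport φ ⊆ Ω →
    ∫ x in Ω, u x * fderiv ℝ φ x (EuclideanSpace.single i 1) = -∫ x in Ω, v x * φ x

/-- The closed ball of radius `R` of `W^{1,p}(Ω)`, as a subset of `L^p(Ω)`: all `u` in `L^p(Ω)` with
weak partial derivatives `∂₁u, …, ∂_N u` in `L^p(Ω)` and `‖u‖_p + ∑ᵢ ‖∂ᵢu‖_p ≤ R`. -/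
def sobolevBall {N : ℕ} (Ω : Set (E N)) (p : ℝ≥0∞) (R : ℝ) : Set (X Ω p) :=
  {u | ∃ v : Fin N → X Ω p, (∀ i, IsWeakPartialDeriv Ω i u (v i)) ∧
    ‖u‖ + ∑ i, ‖v i‖ ≤ R}

/-- `B` is a bounded subset of `W^{1,p}(Ω)`. -/
def IsBoundedInW1p {N : ℕ} (Ω : Set (E N)) (p : ℝ≥0∞) (B : Set (X Ω p)) : Prop :=
  ∃ R : ℝ, B ⊆ sobolevBall Ω p R

end NonlocalEvolution

end

/-!
The key is a closed convex set `slopeBall Ω p B M` of `L^p(Ω)`: the classes of functions that are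
bounded by `B` on `Ω` and Lipschitz with constant `M` along every segment in `Ω`. By Rademacher's
theorem and integration by parts it is a bounded subset of `W^{1,p}(Ω)`
(`slopeBall_subset_sobolevBall`), so it suffices to find `B` and `M` such that it contains every
`A t`.

*A uniform bound in `L^p`.* By the Schur test `K` is a contraction of `L^p(Ω)` (`eLpNorm_K_le`);
since `|g t x| ≤ k₂ + k₁ |x|` with `k₁ < 1`, a Grönwall estimate shows that every solution satisfies
`‖u t‖ ≤ e^{-(1 - k₁)(t - τ)} ‖u τ‖ + R` for a fixed `R` (`IsSolution.norm_le`). Hence the closed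
ball of radius `R` pullback attracts bounded sets and, by minimality, contains every `A t`.

*The forcing term is smoothing.* The bounds on `J` and on its derivative in `L^q(Ω)` make `K u`
bounded (`abs_K_le`) and Lipschitz along segments (`slopeLE_K`), with constants proportional to
`‖u‖`. As `g t` is Lipschitz on bounded sets uniformly in `t`, along solutions starting in the ball
of radius `R` the functions `g(t, K u)` lie in one fixed `slopeBall`
(`exists_nonlinearity_mem_slopeBall`).

*Decay of the distance to `slopeBall`.* By the variation of constants formula, a solution of
`u' = -u + G` with `G` in a closed convex set approaches this set like `e^{-(t - τ)}`
(`IsSolution.exists_mem_norm_sub_le`). By invariance, a point of `A t` is reached from the ball of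
radius `R` at arbitrarily early times `τ`; therefore its distance to `slopeBall` is zero, and it
belongs to `slopeBall` because this set is closed (`isClosed_slopeBall`).
-/

namespace NonlocalEvolution

/-! ### Linear evolution equations with a forcing term -/

section Evolution

variable {F : Type*} [NormedAddCommGroup F] [NormedSpace ℝ F]

/-- A mean value form of the variation of constants formula: if `u' = -u + G` and the forcing `G`
takes values in a closed convex set `S`, then the contribution of `G` to `u t` is a multiple of an
element of `S`. Separating hyperplanes reduce this to Cauchy's mean value theorem, so that no
integral of `G` is needed. -/
theorem exists_mem_eq_exp_smul_add {S : Set F} (hconv : Convex ℝ S) (hcl : IsClosed S)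
    {u G : ℝ → F} {τ t : ℝ} (hτt : τ < t) (hu : ContinuousOn u (Icc τ t))
    (hd : ∀ s ∈ Ioo τ t, HasDerivAt u (-(u s) + G s) s) (hG : ∀ s ∈ Ioo τ t, G s ∈ S) :
    ∃ c ∈ S, u t = Real.exp (-(t - τ)) • u τ + (1 - Real.exp (-(t - τ))) • c := by
  have hpos : 0 < Real.exp t - Real.exp τ := sub_pos.2 (Real.exp_lt_exp.2 hτt)
  refine ⟨(Real.exp t - Real.exp τ)⁻¹ • (Real.exp t • u t - Real.exp τ • u τ), ?_, ?_⟩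
  · by_contra hc
    obtain ⟨l, a, hla, hal⟩ := geometric_hahn_banach_closed_point hconv hcl hc
    obtain ⟨s, hs, hs'⟩ := exists_ratio_hasDerivAt_eq_ratio_slope
      (fun s => l (Real.exp s • u s)) (fun s => Real.exp s * l (G s)) hτt
      (l.continuous.comp_continuousOn (Real.continuous_exp.continuousOn.smul hu))
      (fun s hs => by
        have h := l.hasFDerivAt.comp_hasDerivAt s ((Real.hasDerivAt_exp s).smul (hd s hs))
        refine h.congr_deriv ?_
        simp only [map_add, map_smul, map_neg, smul_eq_mul]
        ring)
      Real.exp Real.exp Real.continuous_exp.continuousOn (fun s _ => Real.hasDerivAt_exp s)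
    have h1 : (Real.exp t - Real.exp τ) * l (G s)
        = l (Real.exp t • u t) - l (Real.exp τ • u τ) := by
      refine mul_left_cancel₀ (Real.exp_pos s).ne' ?_
      linear_combination hs'
    have h2 := hla _ (hG s hs)
    rw [map_smul, map_sub, ← h1, smul_eq_mul, inv_mul_cancel_left₀ hpos.ne'] at hal
    exact absurd h2 (not_lt.2 hal.le)
  · have h : 1 - Real.exp (-(t - τ)) = Real.exp (-t) * (Real.exp t - Real.exp τ) := by
      rw [mul_sub, ← Real.exp_add, ← Real.exp_add]
      simp [neg_add_eq_sub]
    rw [h, smul_smul, mul_assoc, mul_inv_cancel₀ hpos.ne', mul_one, smul_sub, smul_smul, smul_smul,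
      ← Real.exp_add, ← Real.exp_add, neg_add_cancel, Real.exp_zero, one_smul,
      show -(t - τ) = -t + τ by ring, add_sub_cancel]

/-- Grönwall estimate for `u' = -u + G` with a forcing term of linear growth. -/
theorem norm_le_exp_mul_add {u G : ℝ → F} {τ a k R : ℝ}
    (hR : a + k * R < R) (hR0 : 0 ≤ R) (hu : ContinuousOn u (Ici τ))
    (hd : ∀ s, τ ≤ s → HasDerivWithinAt u (-(u s) + G s) (Ici s) s)
    (hG : ∀ s, τ ≤ s → ‖G s‖ ≤ a + k * ‖u s‖) {t : ℝ} (ht : τ ≤ t) :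
    ‖u t‖ ≤ Real.exp (-((1 - k) * (t - τ))) * ‖u τ‖ + R := by
  -- The comparison function is a strict supersolution of `B' = e^s a + k B`.
  have key := image_norm_le_of_norm_deriv_right_lt_deriv_boundary
    (f := fun s => Real.exp s • u s) (f' := fun s => Real.exp s • G s) (a := τ) (b := t)
    ((Real.continuous_exp.continuousOn.smul hu).mono Icc_subset_Ici_self)
    (fun s hs => by
      refine ((Real.hasDerivAt_exp s).hasDerivWithinAt.smul (hd s hs.1)).congr_deriv ?_
      module)
    (B := fun s => Real.exp (k * (s - τ)) * (Real.exp τ * ‖u τ‖) + Real.exp s * R)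
    (B' := fun s => Real.exp (k * (s - τ)) * (k * 1) * (Real.exp τ * ‖u τ‖) + Real.exp s * R)
    (by
      simp only [norm_smul, Real.norm_eq_abs, Real.abs_exp, sub_self, mul_zero, Real.exp_zero,
        one_mul]
      have := Real.exp_pos τ
      nlinarith)
    (fun s => by
      have h1 : HasDerivAt (fun s => k * (s - τ)) (k * 1) s :=
        ((hasDerivAt_id s).sub_const τ).const_mul k
      exact (h1.exp.mul_const _).add ((Real.hasDerivAt_exp s).mul_const R))
    (fun s hs h => by
      simp only [norm_smul, Real.norm_eq_abs, Real.abs_exp] at h ⊢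
      have h1 := mul_le_mul_of_nonneg_left (hG s hs.1) (Real.exp_pos s).le
      have h2 := mul_lt_mul_of_pos_left hR (Real.exp_pos s)
      have h3 : k * (Real.exp s * ‖u s‖) = k * (Real.exp (k * (s - τ)) * (Real.exp τ * ‖u τ‖)
        + Real.exp s * R) := by rw [h]
      linarith)
    (right_mem_Icc.2 ht)
  simp only [norm_smul, Real.norm_eq_abs, Real.abs_exp] at key
  have h : Real.exp (k * (t - τ)) * (Real.exp τ * ‖u τ‖) + Real.exp t * R
      = Real.exp t * (Real.exp (-((1 - k) * (t - τ))) * ‖u τ‖ + R) := by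
    rw [mul_add, ← mul_assoc, ← mul_assoc, ← Real.exp_add, ← Real.exp_add]
    congr 3
    ring_nf
  rw [h] at key
  exact le_of_mul_le_mul_left key (Real.exp_pos t)

/-- A point of norm at most `R + d` has distance at most `d` to the closed ball of radius `R`, so
the exponential decay of the excess over `R` makes this ball pullback attracting. -/
theorem pullbackAttracts_closedBall {S : ℝ → ℝ → F → F} {R k : ℝ} (hR : 0 < R) (hk : k < 1)
    (hS : ∀ t τ w, τ ≤ t → ‖S t τ w‖ ≤ Real.exp (-((1 - k) * (t - τ))) * ‖w‖ + R) :
    PullbackAttracts S (fun _ => Metric.closedBall 0 R) := by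
  intro t C hC
  obtain ⟨ρ, hρ⟩ := hC.exists_norm_le
  set ρ' := max ρ 0
  have hlim : Tendsto (fun τ : ℝ => ENNReal.ofReal (Real.exp (-((1 - k) * (t - τ))) * ρ'))
      atBot (𝓝 0) := by
    rw [← ENNReal.ofReal_zero]
    refine ENNReal.tendsto_ofReal ?_
    have h1 : Tendsto (fun τ : ℝ => -((1 - k) * (t - τ))) atBot atBot := by
      refine tendsto_neg_atTop_atBot.comp (Tendsto.const_mul_atTop (by linarith) ?_)
      exact tendsto_atTop_add_const_left _ t tendsto_neg_atBot_atTop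
    simpa using (Real.tendsto_exp_atBot.comp h1).mul_const ρ'
  refine tendsto_of_tendsto_of_tendsto_of_le_of_le' tendsto_const_nhds hlim
    (Eventually.of_forall fun _ => zero_le) ?_
  filter_upwards [eventually_le_atBot t] with τ hτ
  refine iSup₂_le ?_
  rintro _ ⟨w, hw, rfl⟩
  set d := Real.exp (-((1 - k) * (t - τ))) * ρ'
  have hd : 0 ≤ d := mul_nonneg (Real.exp_pos _).le (le_max_right _ _)
  have hb : ‖S t τ w‖ ≤ R + d := by
    have := mul_le_mul_of_nonneg_left ((hρ w hw).trans (le_max_left ρ 0))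
      (Real.exp_pos (-((1 - k) * (t - τ)))).le
    have := hS t τ w hτ
    simp only [d, ρ']
    linarith
  have hRd : 0 < R + d := by linarith
  have hmem : (R / (R + d)) • S t τ w ∈ Metric.closedBall (0 : F) R := by
    rw [mem_closedBall_zero_iff, norm_smul, Real.norm_of_nonneg (by positivity), div_mul_eq_mul_div,
      div_le_iff₀ hRd]
    gcongr
  refine (Metric.infEDist_le_edist_of_mem hmem).trans ?_
  rw [edist_dist]
  refine ENNReal.ofReal_le_ofReal ?_
  have h2 : S t τ w - (R / (R + d)) • S t τ w = (d / (R + d)) • S t τ w := by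
    rw [show d / (R + d) = 1 - R / (R + d) by field_simp; ring]
    module
  rw [dist_eq_norm, h2, norm_smul, Real.norm_of_nonneg (by positivity), div_mul_eq_mul_div,
    div_le_iff₀ hRd]
  gcongr

end Evolution

/-! ### Bounded functions that are Lipschitz along segments -/

/-- `W` has slope at most `M` along every segment contained in `Ω`. -/
def SlopeLE {N : ℕ} (Ω : Set (E N)) (M : ℝ) (W : E N → ℝ) : Prop :=
  ∀ x z, segment ℝ x z ⊆ Ω → |W x - W z| ≤ M * ‖x - z‖

/-- The classes in `L^p(Ω)` of the functions that are bounded by `B` on `Ω` and have slope at most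
`M` along the segments in `Ω`. -/
def slopeBall {N : ℕ} (Ω : Set (E N)) (p : ℝ≥0∞) (B M : ℝ) : Set (X Ω p) :=
  {f | ∃ W : E N → ℝ, (∀ x ∈ Ω, |W x| ≤ B) ∧ SlopeLE Ω M W ∧ f =ᵐ[volume.restrict Ω] W}

variable {N : ℕ} {Ω : Set (E N)} {p : ℝ≥0∞} {B M : ℝ}

theorem zero_mem_slopeBall (hB : 0 ≤ B) (hM : 0 ≤ M) : (0 : X Ω p) ∈ slopeBall Ω p B M :=
  ⟨0, fun x _ => by simpa using hB, fun x z _ => by simp; positivity, Lp.coeFn_zero _ _ _⟩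

theorem convex_slopeBall : Convex ℝ (slopeBall Ω p B M) := by
  rintro f ⟨W, hB, hM, hf⟩ f' ⟨W', hB', hM', hf'⟩ a b ha hb hab
  refine ⟨fun x => a * W x + b * W' x, fun x hx => ?_, fun x z hxz => ?_, ?_⟩
  · calc |a * W x + b * W' x| ≤ a * |W x| + b * |W' x| := by
          refine (abs_add_le _ _).trans ?_
          rw [abs_mul, abs_mul, abs_of_nonneg ha, abs_of_nonneg hb]
      _ ≤ a * B + b * B := by gcongr; exacts [hB x hx, hB' x hx]
      _ = B := by rw [← add_mul, hab, one_mul]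
  · calc |a * W x + b * W' x - (a * W z + b * W' z)|
          = |a * (W x - W z) + b * (W' x - W' z)| := by congr 1; ring
      _ ≤ a * |W x - W z| + b * |W' x - W' z| := by
          refine (abs_add_le _ _).trans ?_
          rw [abs_mul, abs_mul, abs_of_nonneg ha, abs_of_nonneg hb]
      _ ≤ a * (M * ‖x - z‖) + b * (M * ‖x - z‖) := by
          gcongr; exacts [hM x z hxz, hM' x z hxz]
      _ = M * ‖x - z‖ := by rw [← add_mul, hab, one_mul]
  · filter_upwards [hf, hf', Lp.coeFn_add (a • f) (b • f'), Lp.coeFn_smul a f,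
      Lp.coeFn_smul b f'] with x h1 h2 h3 h4 h5
    rw [h3, Pi.add_apply, h4, h5, Pi.smul_apply, Pi.smul_apply, h1, h2, smul_eq_mul, smul_eq_mul]

/-- The pointwise bounds survive limits in `L^p`: pass to an almost everywhere convergent
subsequence, and take limits along an ultrafilter at the remaining points. -/
theorem isClosed_slopeBall [Fact (1 ≤ p)] (hΩ : MeasurableSet Ω) :
    IsClosed (slopeBall Ω p B M) := by
  refine IsSeqClosed.isClosed fun f f₀ hf hlim => ?_
  obtain ⟨ns, -, hns⟩ := (tendstoInMeasure_of_tendsto_Lp hlim).exists_seq_tendsto_ae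
  choose W hB hM hW using hf
  set 𝒰 : Ultrafilter ℕ := hyperfilter ℕ
  have hex : ∀ x, ∃ w, x ∈ Ω → Tendsto (fun n => W (ns n) x) 𝒰 (𝓝 w) := by
    intro x
    by_cases hx : x ∈ Ω
    · have hmem : ∀ n, W (ns n) x ∈ Icc (-B) B := fun n => abs_le.1 (hB (ns n) x hx)
      obtain ⟨w, -, hw⟩ := isCompact_Icc.ultrafilter_le_nhds (𝒰.map fun n => W (ns n) x)
        (le_principal_iff.2 (mem_map.2 (Eventually.of_forall hmem)))
      exact ⟨w, fun _ => hw⟩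
    · exact ⟨0, fun h => absurd h hx⟩
  choose V hV using hex
  refine ⟨V, fun x hx => ?_, fun x z hxz => ?_, ?_⟩
  · exact le_of_tendsto (hV x hx).abs (Eventually.of_forall fun n => hB (ns n) x hx)
  · exact le_of_tendsto ((hV x (hxz (left_mem_segment ℝ x z))).sub
      (hV z (hxz (right_mem_segment ℝ x z)))).abs (Eventually.of_forall fun n => hM (ns n) x z hxz)
  · filter_upwards [hns, ae_all_iff.2 hW, ae_restrict_mem hΩ] with x hx hWx hxΩ
    have h1 : Tendsto (fun n => W (ns n) x) atTop (𝓝 (f₀ x)) := by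
      simpa only [hWx] using hx
    exact tendsto_nhds_unique (h1.mono_left Nat.hyperfilter_le_atTop) (hV x hxΩ)

theorem norm_le_of_mem_slopeBall [Fact (1 ≤ p)] [IsFiniteMeasure (volume.restrict Ω)]
    (hΩ : MeasurableSet Ω) (hB : 0 ≤ B) {f : X Ω p} (hf : f ∈ slopeBall Ω p B M) :
    ‖f‖ ≤ measureUnivNNReal (volume.restrict Ω) ^ p.toReal⁻¹ * B := by
  obtain ⟨W, hW, -, hfW⟩ := hf
  refine Lp.norm_le_of_ae_bound hB ?_
  filter_upwards [hfW, ae_restrict_mem hΩ] with x h1 h2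
  rw [h1]
  exact hW x h2

/-! ### Weak derivatives of functions that are Lipschitz along segments -/

theorem SlopeLE.lipschitzOnWith {W : E N → ℝ} (hW : SlopeLE Ω M W) (hM : 0 ≤ M) {s : Set (E N)}
    (hs : Convex ℝ s) (hsΩ : s ⊆ Ω) : LipschitzOnWith M.toNNReal W s :=
  LipschitzOnWith.of_dist_le_mul fun x hx z hz => by
    rw [Real.dist_eq, dist_eq_norm, Real.coe_toNNReal _ hM]
    exact hW x z ((hs.segment_subset hx hz).trans hsΩ)

theorem SlopeLE.norm_fderiv_le {W : E N → ℝ} (hW : SlopeLE Ω M W) (hM : 0 ≤ M) (hΩ : IsOpen Ω)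
    {x : E N} (hx : x ∈ Ω) : ‖fderiv ℝ W x‖ ≤ M := by
  obtain ⟨r, hr, hrΩ⟩ := Metric.isOpen_iff.1 hΩ x hx
  refine norm_fderiv_le_of_lip' ℝ hM ?_
  filter_upwards [Metric.ball_mem_nhds x hr] with z hz
  exact hW z x (((convex_ball x r).segment_subset hz (Metric.mem_ball_self hr)).trans hrΩ)

/-- Rademacher's theorem for functions that are Lipschitz along the segments of an open set. -/
theorem SlopeLE.ae_differentiableAt {W : E N → ℝ} (hW : SlopeLE Ω M W) (hM : 0 ≤ M)
    (hΩ : IsOpen Ω) : ∀ᵐ x ∂(volume : Measure (E N)), x ∈ Ω → DifferentiableAt ℝ W x := by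
  rw [ae_iff]
  refine measure_null_of_locally_null _ fun x hx => ?_
  simp only [mem_ofPred_eq, not_forall] at hx
  obtain ⟨r, hr, hrΩ⟩ := Metric.isOpen_iff.1 hΩ x hx.1
  have h := (hW.lipschitzOnWith hM (convex_ball x r) hrΩ).ae_differentiableWithinAt_of_mem
    (μ := volume)
  refine ⟨_, inter_mem_nhdsWithin _ (Metric.ball_mem_nhds x hr), measure_mono_null ?_ (ae_iff.1 h)⟩
  rintro z ⟨hz, hzr⟩ hz'
  simp only [mem_ofPred_eq, not_forall] at hz
  exact hz.2 ((hz' hzr).differentiableAt (Metric.isOpen_ball.mem_nhds hzr))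

/-- The product of a bounded function, Lipschitz along the segments of `Ω`, with a test function
supported in `Ω` is Lipschitz on the whole space: nearby points of which one lies in the support
are joined by a segment in `Ω`, and for distant points boundedness suffices. -/
theorem SlopeLE.exists_lipschitzWith_mul {W φ : E N → ℝ} (hW : SlopeLE Ω M W) (hM : 0 ≤ M)
    (hB : ∀ x ∈ Ω, |W x| ≤ B) (hB0 : 0 ≤ B) (hΩ : IsOpen Ω) (hφ : ContDiff ℝ ∞ φ)
    (hφc : HasCompactSupport φ) (hφΩ : tsupport φ ⊆ Ω) :
    ∃ L, LipschitzWith L fun x => W x * φ x := by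
  obtain ⟨D, hD⟩ := hφ.lipschitzWith_of_hasCompactSupport hφc (by simp)
  obtain ⟨Q, hQ⟩ := hφc.exists_bound_of_continuous hφ.continuous
  have hQ0 : 0 ≤ Q := (norm_nonneg _).trans (hQ 0)
  obtain ⟨δ, hδ, hδΩ⟩ := IsCompact.exists_thickening_subset_open hφc hΩ hφΩ
  have hbd : ∀ x, |W x * φ x| ≤ B * Q := by
    intro x
    by_cases hx : x ∈ tsupport φ
    · rw [abs_mul]
      exact mul_le_mul (hB x (hφΩ hx)) (hQ x) (abs_nonneg _) hB0
    · rw [image_eq_zero_of_notMem_tsupport hx, mul_zero, abs_zero]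
      positivity
  set L : ℝ := M * Q + B * D + 2 * (B * Q) / δ
  have hL1 : 0 ≤ 2 * (B * Q) / δ := by positivity
  -- It suffices to treat pairs whose first point lies in the support of `φ`.
  have key : ∀ x z, x ∈ tsupport φ → |W x * φ x - W z * φ z| ≤ L * ‖x - z‖ := by
    intro x z hx
    rcases lt_or_ge ‖x - z‖ δ with h | h
    · have hball : Metric.ball x δ ⊆ Ω := (Metric.ball_subset_thickening hx δ).trans hδΩ
      have hz : z ∈ Metric.ball x δ := by rwa [mem_ball_iff_norm']
      have hseg := ((convex_ball x δ).segment_subset (Metric.mem_ball_self hδ) hz).trans hball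
      have h1 := hW x z hseg
      have h2 : |φ x - φ z| ≤ D * ‖x - z‖ := by
        simpa [Real.dist_eq, dist_eq_norm] using hD.dist_le_mul x z
      have h3 : |φ x| ≤ Q := hQ x
      calc |W x * φ x - W z * φ z| = |(W x - W z) * φ x + W z * (φ x - φ z)| := by
            congr 1; ring
        _ ≤ |W x - W z| * |φ x| + |W z| * |φ x - φ z| := by
            refine (abs_add_le _ _).trans ?_
            rw [abs_mul, abs_mul]
        _ ≤ M * ‖x - z‖ * Q + B * (D * ‖x - z‖) := by
            gcongr
            exact hB z (hball hz)
        _ ≤ L * ‖x - z‖ := by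
            have := mul_nonneg hL1 (norm_nonneg (x - z))
            simp only [L]
            linarith
    · have h4 : 2 * (B * Q) ≤ 2 * (B * Q) / δ * ‖x - z‖ := by
        rw [div_mul_eq_mul_div, le_div_iff₀ hδ]
        gcongr
      have h5 : 0 ≤ (M * Q + B * D) * ‖x - z‖ := by positivity
      have h6 := (abs_sub (W x * φ x) (W z * φ z)).trans (add_le_add (hbd x) (hbd z))
      simp only [L]
      linarith
  refine ⟨L.toNNReal, LipschitzWith.of_dist_le_mul fun x z => ?_⟩
  have hL : 0 ≤ L := by positivity
  rw [Real.dist_eq, dist_eq_norm, Real.coe_toNNReal _ hL]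
  by_cases hx : x ∈ tsupport φ
  · exact key x z hx
  by_cases hz : z ∈ tsupport φ
  · rw [abs_sub_comm, norm_sub_rev]
    exact key z x hz
  · rw [image_eq_zero_of_notMem_tsupport hx, image_eq_zero_of_notMem_tsupport hz]
    simp only [mul_zero, sub_self, abs_zero]
    positivity

/-- The almost everywhere defined partial derivatives are the weak partial derivatives. -/
theorem SlopeLE.isWeakPartialDeriv {W : E N → ℝ} (hW : SlopeLE Ω M W) (hM : 0 ≤ M)
    (hB : ∀ x ∈ Ω, |W x| ≤ B) (hB0 : 0 ≤ B) (hΩ : IsOpen Ω)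
    (hWm : AEStronglyMeasurable W (volume.restrict Ω)) (i : Fin N) :
    IsWeakPartialDeriv Ω i W fun x => fderiv ℝ W x (EuclideanSpace.single i 1) := by
  intro φ hφ hφc hφΩ
  set e : E N := EuclideanSpace.single i 1
  obtain ⟨L, hL⟩ := hW.exists_lipschitzWith_mul hM hB hB0 hΩ hφ hφc hφΩ
  have hsupp : HasCompactSupport fun x => W x * φ x := hφc.mul_left
  -- The integral of the derivative of a compactly supported Lipschitz function vanishes.
  have h0 : ∫ x, lineDeriv ℝ (fun x => W x * φ x) x e = 0 := by
    have h := (LipschitzWith.const (1 : ℝ)).integral_lineDeriv_mul_eq (μ := volume) hL hsupp (-e)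
    simpa [lineDeriv] using h.symm
  have hae : ∀ᵐ x ∂volume, lineDeriv ℝ (fun x => W x * φ x) x e =
      Ω.indicator (fun x => W x * fderiv ℝ φ x e + fderiv ℝ W x e * φ x) x := by
    filter_upwards [hW.ae_differentiableAt hM hΩ] with x hx
    by_cases hxΩ : x ∈ Ω
    · have hφx : DifferentiableAt ℝ φ x := hφ.differentiable (by simp) x
      have h := ((hx hxΩ).hasFDerivAt.mul hφx.hasFDerivAt).hasLineDerivAt e
      rw [indicator_of_mem hxΩ]
      refine h.lineDeriv.trans ?_
      simp [mul_comm]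
    · rw [indicator_of_notMem hxΩ]
      have hx' : x ∉ tsupport φ := fun h => hxΩ (hφΩ h)
      have hev : (fun x => W x * φ x) =ᶠ[𝓝 x] fun _ => 0 := by
        filter_upwards [notMem_tsupport_iff_eventuallyEq.1 hx'] with y hy
        simp [hy]
      rw [hev.lineDeriv_eq]
      simp [lineDeriv]
  have hφ' : Continuous fun x => fderiv ℝ φ x e :=
    (hφ.continuous_fderiv (by simp)).clm_apply continuous_const
  have hφ'c : HasCompactSupport fun x => fderiv ℝ φ x e := hφc.fderiv_apply ℝ e
  have hmem := ae_restrict_mem (μ := (volume : Measure (E N))) hΩ.measurableSet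
  have hi1 : IntegrableOn (fun x => W x * fderiv ℝ φ x e) Ω :=
    ((hφ'.integrable_of_hasCompactSupport hφ'c).integrableOn).bdd_mul hWm
      (hmem.mono fun x hx => hB x hx)
  have hi2 : IntegrableOn (fun x => fderiv ℝ W x e * φ x) Ω := by
    refine ((hφ.continuous.integrable_of_hasCompactSupport hφc).integrableOn).bdd_mul
      (measurable_fderiv_apply_const ℝ W e).aestronglyMeasurable (c := M * ‖e‖)
      (hmem.mono fun x hx => ?_)
    exact ((fderiv ℝ W x).le_opNorm e).trans
      (mul_le_mul_of_nonneg_right (hW.norm_fderiv_le hM hΩ hx) (norm_nonneg _))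
  rw [integral_congr_ae hae, integral_indicator hΩ.measurableSet, integral_add hi1 hi2] at h0
  linarith

/-- Functions that are bounded and Lipschitz along segments belong to `W^{1,p}(Ω)`, with a bound
that depends only on the constants. -/
theorem slopeBall_subset_sobolevBall [Fact (1 ≤ p)] [IsFiniteMeasure (volume.restrict Ω)]
    (hΩ : IsOpen Ω) (hB : 0 ≤ B) (hM : 0 ≤ M) :
    slopeBall Ω p B M ⊆ sobolevBall Ω p
      (measureUnivNNReal (volume.restrict Ω) ^ p.toReal⁻¹ * B +
        N * (measureUnivNNReal (volume.restrict Ω) ^ p.toReal⁻¹ * M)) := by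
  intro f hf
  have hfB := norm_le_of_mem_slopeBall hΩ.measurableSet hB hf
  obtain ⟨W, hWB, hWM, hfW⟩ := hf
  have hWm : AEStronglyMeasurable W (volume.restrict Ω) :=
    (Lp.aestronglyMeasurable f).congr hfW
  have hbd : ∀ i : Fin N, ∀ᵐ x ∂(volume : Measure (E N)).restrict Ω,
      ‖fderiv ℝ W x (EuclideanSpace.single i 1)‖ ≤ M := by
    intro i
    filter_upwards [ae_restrict_mem hΩ.measurableSet] with x hx
    refine ((fderiv ℝ W x).le_opNorm _).trans ?_
    simpa using hWM.norm_fderiv_le hM hΩ hx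
  have hmem : ∀ i : Fin N, MemLp (fun x => fderiv ℝ W x (EuclideanSpace.single i 1)) p
      (volume.restrict Ω) := fun i =>
    MemLp.of_bound (measurable_fderiv_apply_const ℝ W _).aestronglyMeasurable M (hbd i)
  refine ⟨fun i => (hmem i).toLp _, fun i φ hφ hφc hφΩ => ?_, ?_⟩
  · have h := hWM.isWeakPartialDeriv hM hWB hB hΩ hWm i φ hφ hφc hφΩ
    rw [integral_congr_ae (g := fun x => W x * fderiv ℝ φ x (EuclideanSpace.single i 1))
      (hfW.mono fun x hx => by simp [hx]), h]
    refine congrArg _ (integral_congr_ae ?_)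
    filter_upwards [(hmem i).coeFn_toLp] with x hx
    rw [hx]
  · refine add_le_add hfB ((Finset.sum_le_card_nsmul _ _ _ fun i _ =>
      Lp.norm_le_of_ae_bound hM ?_).trans (by simp))
    filter_upwards [(hmem i).coeFn_toLp, hbd i] with x h1 h2
    rwa [h1]

/-! ### Estimates for the integral operator -/

section Kernel

variable {N : ℕ} {Ω : Set (E N)} {p q : ℝ≥0∞} {J : E N → E N → ℝ} {u : E N → ℝ}

theorem stronglyMeasurable_K (hJm : Measurable (Function.uncurry J)) (hu : StronglyMeasurable u) :
    StronglyMeasurable (K Ω J u) :=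
  StronglyMeasurable.integral_prod_right
    (hJm.stronglyMeasurable.mul (hu.comp_measurable measurable_snd))

theorem lintegral_ofReal_kernel_le (hJ0 : ∀ x y, 0 ≤ J x y) (hJ1 : ∀ x, ∫ y, J x y = 1)
    (x : E N) : ∫⁻ y in Ω, ENNReal.ofReal (J x y) ≤ 1 := by
  have hint : Integrable (J x) := by
    by_contra h
    have := hJ1 x
    rw [integral_undef h] at this
    exact zero_ne_one this
  refine (setLIntegral_le_lintegral _ _).trans ?_
  rw [← ofReal_integral_eq_lintegral_ofReal hint (Eventually.of_forall (hJ0 x)), hJ1 x,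
    ENNReal.ofReal_one]

/-- The average of `u` against the sub-probability density `J x` is controlled by its `L^p` norm
for that density (Jensen's inequality). -/
theorem enorm_K_le_eLpNorm_withDensity (hp : 1 ≤ p) (hJm : Measurable (Function.uncurry J))
    (hJ0 : ∀ x y, 0 ≤ J x y) (hJ1 : ∀ x, ∫ y, J x y = 1) (hu : StronglyMeasurable u) (x : E N) :
    ‖K Ω J u x‖ₑ ≤
      eLpNorm u p ((volume.restrict Ω).withDensity fun y => ENNReal.ofReal (J x y)) := by
  have hJx : Measurable fun y => ENNReal.ofReal (J x y) :=
    (hJm.comp measurable_prodMk_left).ennreal_ofReal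
  set ν := (volume.restrict Ω).withDensity fun y => ENNReal.ofReal (J x y)
  have hν : ν univ ≤ 1 := by
    rw [withDensity_apply _ MeasurableSet.univ, Measure.restrict_univ]
    exact lintegral_ofReal_kernel_le hJ0 hJ1 x
  have hexp : 0 ≤ 1 / (1 : ℝ≥0∞).toReal - 1 / p.toReal := by
    rcases eq_or_ne p ∞ with rfl | hp'
    · simp
    · have : 1 ≤ p.toReal := by simpa using ENNReal.toReal_mono hp' hp
      simpa using inv_le_one_of_one_le₀ this
  calc ‖K Ω J u x‖ₑ ≤ ∫⁻ y in Ω, ‖J x y * u y‖ₑ := enorm_integral_le_lintegral_enorm _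
    _ = ∫⁻ y, ‖u y‖ₑ ∂ν := by
        rw [lintegral_withDensity_eq_lintegral_mul _ hJx hu.measurable.enorm]
        refine lintegral_congr fun y => ?_
        rw [enorm_mul, Real.enorm_of_nonneg (hJ0 x y), Pi.mul_apply]
    _ = eLpNorm u 1 ν := (eLpNorm_one_eq_lintegral_enorm).symm
    _ ≤ eLpNorm u p ν * ν univ ^ (1 / (1 : ℝ≥0∞).toReal - 1 / p.toReal) :=
        eLpNorm_le_eLpNorm_mul_rpow_measure_univ hp hu.aestronglyMeasurable
    _ ≤ eLpNorm u p ν * 1 := by gcongr; exact ENNReal.rpow_le_one hν hexp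
    _ = eLpNorm u p ν := mul_one _

/-- The Schur test: `K` is a contraction of `L^p(Ω)`. -/
theorem eLpNorm_K_le (hp : 1 ≤ p) (hJm : Measurable (Function.uncurry J))
    (hJ0 : ∀ x y, 0 ≤ J x y) (hJsymm : ∀ x y, J x y = J y x) (hJ1 : ∀ x, ∫ y, J x y = 1)
    (hu : StronglyMeasurable u) :
    eLpNorm (K Ω J u) p (volume.restrict Ω) ≤ eLpNorm u p (volume.restrict Ω) := by
  have hpt := enorm_K_le_eLpNorm_withDensity (Ω := Ω) hp hJm hJ0 hJ1 hu
  rcases eq_or_ne p ∞ with rfl | hp'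
  · rw [eLpNorm_exponent_top, eLpNorm_exponent_top]
    refine eLpNormEssSup_le_of_ae_enorm_bound (Eventually.of_forall fun x => (hpt x).trans ?_)
    rw [eLpNorm_exponent_top]
    exact eLpNormEssSup_mono_measure _ (withDensity_absolutelyContinuous _ _)
  have hp0 : p ≠ 0 := (zero_lt_one.trans_le hp).ne'
  have hpp : 0 < p.toReal := ENNReal.toReal_pos hp0 hp'
  have hm : Measurable fun y => ‖u y‖ₑ ^ p.toReal := hu.measurable.enorm.pow_const _
  have hJm' : Measurable fun z : E N × E N => ENNReal.ofReal (J z.1 z.2) := hJm.ennreal_ofReal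
  rw [eLpNorm_eq_lintegral_rpow_enorm_toReal hp0 hp',
    eLpNorm_eq_lintegral_rpow_enorm_toReal hp0 hp']
  refine ENNReal.rpow_le_rpow ?_ (by positivity)
  calc ∫⁻ x in Ω, ‖K Ω J u x‖ₑ ^ p.toReal
      ≤ ∫⁻ x in Ω, ∫⁻ y in Ω, ENNReal.ofReal (J x y) * ‖u y‖ₑ ^ p.toReal := by
        refine lintegral_mono fun x => ?_
        refine (ENNReal.rpow_le_rpow (hpt x) hpp.le).trans_eq ?_
        rw [eLpNorm_eq_lintegral_rpow_enorm_toReal hp0 hp', ← ENNReal.rpow_mul,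
          one_div_mul_cancel hpp.ne', ENNReal.rpow_one]
        exact lintegral_withDensity_eq_lintegral_mul _ (hJm'.comp measurable_prodMk_left) hm
    _ = ∫⁻ y in Ω, ∫⁻ x in Ω, ENNReal.ofReal (J x y) * ‖u y‖ₑ ^ p.toReal :=
        lintegral_lintegral_swap (hJm'.mul (hm.comp measurable_snd)).aemeasurable
    _ ≤ ∫⁻ y in Ω, ‖u y‖ₑ ^ p.toReal := by
        refine lintegral_mono fun y => ?_
        have hJy : Measurable fun x => ENNReal.ofReal (J x y) := hJm'.comp measurable_prodMk_right
        rw [lintegral_mul_const _ hJy]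
        simp_rw [fun x => hJsymm x y]
        exact mul_le_of_le_one_left zero_le (lintegral_ofReal_kernel_le hJ0 hJ1 y)

theorem lintegral_enorm_mul_enorm_le_eLpNorm (hpq : p.HolderConjugate q) {α : Type*}
    [MeasurableSpace α] {μ : Measure α} {a b : α → ℝ} (ha : AEStronglyMeasurable a μ)
    (hb : AEStronglyMeasurable b μ) :
    ∫⁻ y, ‖a y‖ₑ * ‖b y‖ₑ ∂μ ≤ eLpNorm a q μ * eLpNorm b p μ := by
  have : q.HolderTriple p 1 := hpq.symm
  have h := eLpNorm_smul_le_mul_eLpNorm (p := q) (q := p) (r := 1) hb ha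
  rw [eLpNorm_one_eq_lintegral_enorm] at h
  simpa [enorm_mul] using h

theorem integrable_kernel_mul (hpq : p.HolderConjugate q) (hJm : Measurable (Function.uncurry J))
    {x : E N} (hx : eLpNorm (J x) q (volume.restrict Ω) ≠ ⊤) (hu : MemLp u p (volume.restrict Ω)) :
    Integrable (fun y => J x y * u y) (volume.restrict Ω) := by
  have hJx : AEStronglyMeasurable (J x) (volume.restrict Ω) :=
    (hJm.comp measurable_prodMk_left).aestronglyMeasurable
  refine ⟨hJx.mul hu.1, ?_⟩
  have h := lintegral_enorm_mul_enorm_le_eLpNorm hpq hJx hu.1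
  simp only [← enorm_mul] at h
  exact h.trans_lt (ENNReal.mul_lt_top hx.lt_top hu.2)

theorem abs_K_le (hpq : p.HolderConjugate q) (hJm : Measurable (Function.uncurry J)) {C : ℝ}
    (hC : 0 ≤ C) {x : E N} (hx : eLpNorm (J x) q (volume.restrict Ω) ≤ ENNReal.ofReal C)
    (hu : MemLp u p (volume.restrict Ω)) :
    |K Ω J u x| ≤ C * (eLpNorm u p (volume.restrict Ω)).toReal := by
  have hJx : AEStronglyMeasurable (J x) (volume.restrict Ω) :=
    (hJm.comp measurable_prodMk_left).aestronglyMeasurable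
  have h : ‖K Ω J u x‖ₑ ≤ ENNReal.ofReal C * eLpNorm u p (volume.restrict Ω) := by
    refine (enorm_integral_le_lintegral_enorm _).trans ?_
    simp only [enorm_mul]
    exact (lintegral_enorm_mul_enorm_le_eLpNorm hpq hJx hu.1).trans (by gcongr)
  have h' := ENNReal.toReal_mono (ENNReal.mul_ne_top ENNReal.ofReal_ne_top hu.2.ne) h
  rwa [toReal_enorm, Real.norm_eq_abs, ENNReal.toReal_mul, ENNReal.toReal_ofReal hC] at h'

/-- A differentiable function changes by at most the integral of its derivative; this is trivially
true if the derivative is not integrable. -/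
theorem enorm_sub_le_lintegral_enorm_deriv {h : ℝ → ℝ}
    (hd : ∀ s ∈ Icc (0 : ℝ) 1, DifferentiableAt ℝ h s) :
    ‖h 1 - h 0‖ₑ ≤ ∫⁻ s in Icc (0 : ℝ) 1, ‖deriv h s‖ₑ := by
  by_cases hfin : ∫⁻ s in Icc (0 : ℝ) 1, ‖deriv h s‖ₑ = ⊤
  · rw [hfin]
    exact le_top
  have hint : IntegrableOn (deriv h) (Icc 0 1) :=
    ⟨(measurable_deriv h).aestronglyMeasurable, lt_top_iff_ne_top.2 hfin⟩
  have hint' : IntervalIntegrable (deriv h) volume 0 1 :=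
    (intervalIntegrable_iff_integrableOn_Icc_of_le zero_le_one).2 hint
  rw [← intervalIntegral.integral_eq_sub_of_hasDerivAt
    (fun s hs => (hd s (by rwa [uIcc_of_le zero_le_one] at hs)).hasDerivAt) hint',
    intervalIntegral.integral_of_le zero_le_one]
  exact (enorm_integral_le_lintegral_enorm _).trans (lintegral_mono_set Ioc_subset_Icc_self)

/-- Derivatives with respect to a parameter are measurable, as limits of difference quotients along
a fixed sequence. -/
theorem aemeasurable_of_hasDerivAt_of_tendsto {α : Type*} [MeasurableSpace α] {μ : Measure α}
    {f : ℝ → α → ℝ} {f' : α → ℝ} (hf : ∀ t, Measurable (f t))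
    (hd : ∀ᵐ a ∂μ, HasDerivAt (fun t => f t a) (f' a) 0) : AEMeasurable f' μ := by
  have hseq : Tendsto (fun n : ℕ => 1 / ((n : ℝ) + 1)) atTop (𝓝[>] 0) :=
    tendsto_nhdsWithin_iff.2 ⟨tendsto_one_div_add_atTop_nhds_zero_nat,
      Eventually.of_forall fun n => by simp only [mem_Ioi]; positivity⟩
  refine aemeasurable_of_tendsto_metrizable_ae atTop
    (f := fun (n : ℕ) a => (1 / ((n : ℝ) + 1))⁻¹ • (f (0 + 1 / ((n : ℝ) + 1)) a - f 0 a))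
    (fun n => (((hf (0 + 1 / ((n : ℝ) + 1))).sub (hf 0)).const_smul
      (1 / ((n : ℝ) + 1))⁻¹).aemeasurable) ?_
  filter_upwards [hd] with a ha
  exact ha.tendsto_slope_zero_right.comp hseq

/-- `K u` is Lipschitz along segments. Differentiation under the integral sign is not available
pointwise, since the derivative of `J` is only bounded in `L^q` at each point; but on average over
a segment the fundamental theorem of calculus and Tonelli's theorem give the same bound. -/
theorem slopeLE_K (hpq : p.HolderConjugate q) (hJm : Measurable (Function.uncurry J))
    (hΩ : IsOpen Ω) (hJq : ∀ x ∈ Ω, eLpNorm (J x) q (volume.restrict Ω) ≠ ⊤)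
    (hJd : ∀ x ∈ Ω, ∀ y ∈ Ω, DifferentiableAt ℝ (fun z => J z y) x) {C : ℝ} (hC : 0 ≤ C)
    (hJxq : ∀ x ∈ Ω, eLpNorm (fun y => fderiv ℝ (fun z => J z y) x) q (volume.restrict Ω) ≤
      ENNReal.ofReal C) (hu : StronglyMeasurable u) (hup : MemLp u p (volume.restrict Ω)) :
    SlopeLE Ω (C * (eLpNorm u p (volume.restrict Ω)).toReal) (K Ω J u) := by
  intro x z hxz
  set γ : ℝ → E N := fun s => z + s • (x - z)
  have hγd : ∀ s, HasDerivAt γ (x - z) s := fun s => by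
    exact (((hasDerivAt_id s).smul_const (x - z)).const_add z).congr_deriv (one_smul _ _)
  have hγc : Continuous γ := by fun_prop
  have hγΩ : ∀ s ∈ Icc (0 : ℝ) 1, γ s ∈ Ω := fun s hs => by
    refine hxz (segment_symm ℝ z x ▸ ?_)
    rw [segment_eq_image']
    exact ⟨s, hs, rfl⟩
  have hγ0 : γ 0 = z := by simp [γ]
  have hγ1 : γ 1 = x := by simp [γ]
  set D : ℝ → E N → ℝ := fun s y => deriv (fun s => J (γ s) y) s
  have hD : ∀ s ∈ Icc (0 : ℝ) 1, ∀ y ∈ Ω, HasDerivAt (fun s => J (γ s) y)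
      (fderiv ℝ (fun w => J w y) (γ s) (x - z)) s := fun s hs y hy =>
    (hJd (γ s) (hγΩ s hs) y hy).hasFDerivAt.comp_hasDerivAt s (hγd s)
  have hD' : ∀ s ∈ Icc (0 : ℝ) 1, ∀ y ∈ Ω,
      HasDerivAt (fun t => J (γ (s + t)) y) (D s y) 0 := fun s hs y hy => by
    have h : HasDerivAt (fun s => J (γ s) y) (D s y) (s + 0) := by
      rw [add_zero]
      exact (hD s hs y hy).differentiableAt.hasDerivAt
    exact h.comp_const_add s 0
  have hDm : AEMeasurable (Function.uncurry D)
      ((volume.restrict (Icc (0 : ℝ) 1)).prod (volume.restrict Ω)) := by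
    refine aemeasurable_of_hasDerivAt_of_tendsto (f := fun t (a : ℝ × E N) => J (γ (a.1 + t)) a.2)
      (fun t => hJm.comp (Measurable.prodMk (hγc.measurable.comp (measurable_fst.add_const t))
        measurable_snd)) ?_
    rw [Measure.prod_restrict]
    filter_upwards [ae_restrict_mem (measurableSet_Icc.prod hΩ.measurableSet)] with a ha
    exact hD' a.1 ha.1 a.2 ha.2
  have hDsm : ∀ s ∈ Icc (0 : ℝ) 1, AEMeasurable (D s) (volume.restrict Ω) := fun s hs => by
    refine aemeasurable_of_hasDerivAt_of_tendsto (f := fun t y => J (γ (s + t)) y)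
      (fun t => hJm.comp measurable_prodMk_left) ?_
    filter_upwards [ae_restrict_mem hΩ.measurableSet] with y hy
    exact hD' s hs y hy
  have hDq : ∀ s ∈ Icc (0 : ℝ) 1, eLpNorm (D s) q (volume.restrict Ω) ≤
      ENNReal.ofReal ‖x - z‖ * ENNReal.ofReal C := fun s hs => by
    refine (eLpNorm_le_mul_eLpNorm_of_ae_le_mul (c := ‖x - z‖)
      (g := fun y => fderiv ℝ (fun w => J w y) (γ s)) ?_ q).trans ?_
    · filter_upwards [ae_restrict_mem hΩ.measurableSet] with y hy
      simp only [D]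
      rw [(hD s hs y hy).deriv, mul_comm]
      exact (fderiv ℝ (fun w => J w y) (γ s)).le_opNorm _
    · gcongr
      exact hJxq (γ s) (hγΩ s hs)
  have hxΩ : x ∈ Ω := hxz (left_mem_segment ℝ x z)
  have hzΩ : z ∈ Ω := hxz (right_mem_segment ℝ x z)
  have hdiff : K Ω J u x - K Ω J u z = ∫ y in Ω, (J x y - J z y) * u y := by
    simp only [K, sub_mul]
    exact (integral_sub (integrable_kernel_mul hpq hJm (hJq x hxΩ) hup)
      (integrable_kernel_mul hpq hJm (hJq z hzΩ) hup)).symm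
  have key : ‖K Ω J u x - K Ω J u z‖ₑ ≤
      ENNReal.ofReal ‖x - z‖ * ENNReal.ofReal C * eLpNorm u p (volume.restrict Ω) := by
    calc ‖K Ω J u x - K Ω J u z‖ₑ ≤ ∫⁻ y in Ω, ‖J x y - J z y‖ₑ * ‖u y‖ₑ := by
          rw [hdiff]
          refine (enorm_integral_le_lintegral_enorm _).trans_eq ?_
          simp only [enorm_mul]
      _ ≤ ∫⁻ y in Ω, ∫⁻ s in Icc (0 : ℝ) 1, ‖D s y‖ₑ * ‖u y‖ₑ := by
          refine setLIntegral_mono' hΩ.measurableSet fun y hy => ?_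
          have h := enorm_sub_le_lintegral_enorm_deriv
            (fun s hs => (hD s hs y hy).differentiableAt)
          rw [hγ0, hγ1] at h
          rw [lintegral_mul_const _ (measurable_deriv _).enorm]
          gcongr
      _ = ∫⁻ s in Icc (0 : ℝ) 1, ∫⁻ y in Ω, ‖D s y‖ₑ * ‖u y‖ₑ :=
          (lintegral_lintegral_swap (hDm.enorm.mul
            (hu.measurable.enorm.comp measurable_snd).aemeasurable)).symm
      _ ≤ ∫⁻ _ in Icc (0 : ℝ) 1,
            ENNReal.ofReal ‖x - z‖ * ENNReal.ofReal C * eLpNorm u p (volume.restrict Ω) := by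
          refine setLIntegral_mono' measurableSet_Icc fun s hs => ?_
          refine (lintegral_enorm_mul_enorm_le_eLpNorm hpq
            (hDsm s hs).aestronglyMeasurable hup.1).trans ?_
          gcongr
          exact hDq s hs
      _ = _ := by simp
  have h' := ENNReal.toReal_mono (ENNReal.mul_ne_top (ENNReal.mul_ne_top ENNReal.ofReal_ne_top
    ENNReal.ofReal_ne_top) hup.2.ne) key
  rw [toReal_enorm, Real.norm_eq_abs, ENNReal.toReal_mul, ENNReal.toReal_mul,
    ENNReal.toReal_ofReal hC, ENNReal.toReal_ofReal (norm_nonneg _)] at h'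
  linarith

end Kernel

/-! ### The nonlinear term and the process -/

section Dynamics

variable {N : ℕ} {Ω : Set (E N)} {p q : ℝ≥0∞} {J : E N → E N → ℝ} {g : ℝ → ℝ → ℝ}

/-- Linear growth of `g` and the contraction property of `K` bound the forcing term in `L^p(Ω)`. -/
theorem norm_le_of_ae_eq_nonlinearity [Fact (1 ≤ p)] [IsFiniteMeasure (volume.restrict Ω)]
    (hJm : Measurable (Function.uncurry J)) (hJ0 : ∀ x y, 0 ≤ J x y)
    (hJsymm : ∀ x y, J x y = J y x) (hJ1 : ∀ x, ∫ y, J x y = 1) {k₁ k₂ : ℝ} (hk₁ : 0 ≤ k₁)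
    (hg : ∀ t x, |g t x| ≤ k₂ + k₁ * |x|) {t : ℝ} {u G : X Ω p}
    (hG : G =ᵐ[volume.restrict Ω] fun x => g t (K Ω J u x)) :
    ‖G‖ ≤ (eLpNorm (fun _ : E N => k₂) p (volume.restrict Ω)).toReal + k₁ * ‖u‖ := by
  have hu := Lp.stronglyMeasurable u
  have hK := stronglyMeasurable_K (Ω := Ω) hJm hu
  have h : eLpNorm G p (volume.restrict Ω) ≤ eLpNorm (fun _ : E N => k₂) p (volume.restrict Ω) +
      ENNReal.ofReal k₁ * eLpNorm u p (volume.restrict Ω) := by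
    calc eLpNorm G p (volume.restrict Ω)
        ≤ eLpNorm ((fun _ : E N => k₂) + fun x => k₁ * |K Ω J u x|) p (volume.restrict Ω) := by
          refine eLpNorm_mono_ae_real ?_
          filter_upwards [hG] with x hx
          rw [hx]
          exact hg t _
      _ ≤ eLpNorm (fun _ : E N => k₂) p (volume.restrict Ω) +
          eLpNorm (fun x => k₁ * |K Ω J u x|) p (volume.restrict Ω) :=
        eLpNorm_add_le aestronglyMeasurable_const
          (hK.norm.const_mul k₁).aestronglyMeasurable Fact.out
      _ ≤ _ := by
        gcongr
        refine (eLpNorm_le_mul_eLpNorm_of_ae_le_mul (c := k₁) (g := K Ω J u)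
          (Eventually.of_forall fun x => ?_) p).trans ?_
        · rw [norm_mul, Real.norm_of_nonneg hk₁, Real.norm_eq_abs, abs_abs, Real.norm_eq_abs]
        · gcongr
          exact eLpNorm_K_le Fact.out hJm hJ0 hJsymm hJ1 hu
  have hc : eLpNorm (fun _ : E N => k₂) p (volume.restrict Ω) ≠ ⊤ := (memLp_const k₂).2.ne
  have hu' : ENNReal.ofReal k₁ * eLpNorm u p (volume.restrict Ω) ≠ ⊤ :=
    ENNReal.mul_ne_top ENNReal.ofReal_ne_top (Lp.eLpNorm_ne_top u)
  have h' := ENNReal.toReal_mono (ENNReal.add_ne_top.2 ⟨hc, hu'⟩) h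
  rwa [ENNReal.toReal_add hc hu', ENNReal.toReal_mul, ENNReal.toReal_ofReal hk₁, ← Lp.norm_def,
    ← Lp.norm_def] at h'

/-- A solution solves a linear equation in `L^p(Ω)` with forcing term `g(t, K u)`. -/
theorem IsSolution.exists_forcing [Fact (1 ≤ p)] {τ : ℝ} {u₀ : X Ω p} {u : ℝ → X Ω p}
    (hu : IsSolution Ω p J g τ u₀ u) : ∃ G : ℝ → X Ω p, ∀ t, τ ≤ t →
      HasDerivWithinAt u (-(u t) + G t) (Ici τ) t ∧
        G t =ᵐ[volume.restrict Ω] fun x => g t (K Ω J (u t) x) := by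
  choose! u' hd hae using hu.equation
  refine ⟨fun t => u t + u' t, fun t ht => ⟨by simpa using hd t ht, ?_⟩⟩
  filter_upwards [hae t ht, Lp.coeFn_add (u t) (u' t)] with x h1 h2
  rw [h2, Pi.add_apply, h1]
  ring

theorem IsSolution.norm_le [Fact (1 ≤ p)] [IsFiniteMeasure (volume.restrict Ω)]
    (hJm : Measurable (Function.uncurry J)) (hJ0 : ∀ x y, 0 ≤ J x y)
    (hJsymm : ∀ x y, J x y = J y x) (hJ1 : ∀ x, ∫ y, J x y = 1) {k₁ k₂ R : ℝ} (hk₁ : 0 ≤ k₁)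
    (hg : ∀ t x, |g t x| ≤ k₂ + k₁ * |x|) (hR0 : 0 ≤ R)
    (hR : (eLpNorm (fun _ : E N => k₂) p (volume.restrict Ω)).toReal + k₁ * R < R)
    {τ : ℝ} {u₀ : X Ω p} {u : ℝ → X Ω p} (hu : IsSolution Ω p J g τ u₀ u) {t : ℝ} (ht : τ ≤ t) :
    ‖u t‖ ≤ Real.exp (-((1 - k₁) * (t - τ))) * ‖u₀‖ + R := by
  obtain ⟨G, hG⟩ := hu.exists_forcing
  have h := norm_le_exp_mul_add hR hR0 hu.continuousOn
    (fun s hs => (hG s hs).1.mono (Ici_subset_Ici.2 hs))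
    (fun s hs => norm_le_of_ae_eq_nonlinearity hJm hJ0 hJsymm hJ1 hk₁ hg (hG s hs).2) ht
  rwa [hu.initial] at h

/-- For `u` in a ball of `L^p(Ω)`, the functions `g(t, K u)` are bounded and Lipschitz along
segments, uniformly in `u` and `t`. -/
theorem exists_nonlinearity_mem_slopeBall [Fact (1 ≤ p)] (hpq : p.HolderConjugate q)
    (hΩ : IsOpen Ω) (hJm : Measurable (Function.uncurry J))
    (hJq : ∃ C : ℝ, ∀ x ∈ Ω, eLpNorm (J x) q (volume.restrict Ω) ≤ ENNReal.ofReal C)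
    (hJd : ∀ x ∈ Ω, ∀ y ∈ Ω, DifferentiableAt ℝ (fun z => J z y) x)
    (hJxq : ∃ C : ℝ, ∀ x ∈ Ω,
      eLpNorm (fun y => fderiv ℝ (fun z => J z y) x) q (volume.restrict Ω) ≤ ENNReal.ofReal C)
    (hgc : ContDiff ℝ 1 (Function.uncurry g)) {k₁ k₂ : ℝ} (hk₁ : 0 ≤ k₁)
    (hg : ∀ t x, |g t x| ≤ k₂ + k₁ * |x|)
    (hgd : ∀ r : ℝ, ∃ k : ℝ, ∀ t x, |x| ≤ r → |deriv (g t) x| ≤ k) {ρ : ℝ} (hρ : 0 ≤ ρ) :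
    ∃ B M : ℝ, 0 ≤ B ∧ 0 ≤ M ∧ ∀ (t : ℝ) (u G : X Ω p), ‖u‖ ≤ ρ →
      G =ᵐ[volume.restrict Ω] (fun x => g t (K Ω J u x)) → G ∈ slopeBall Ω p B M := by
  obtain ⟨C, hC⟩ := hJq
  obtain ⟨C', hC'⟩ := hJxq
  have hC0 : ∀ x ∈ Ω, eLpNorm (J x) q (volume.restrict Ω) ≤ ENNReal.ofReal (max C 0) :=
    fun x hx => (hC x hx).trans (ENNReal.ofReal_le_ofReal (le_max_left _ _))
  have hC'0 : ∀ x ∈ Ω, eLpNorm (fun y => fderiv ℝ (fun z => J z y) x) q (volume.restrict Ω) ≤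
      ENNReal.ofReal (max C' 0) :=
    fun x hx => (hC' x hx).trans (ENNReal.ofReal_le_ofReal (le_max_left _ _))
  set r := max C 0 * ρ
  have hr : 0 ≤ r := mul_nonneg (le_max_right _ _) hρ
  obtain ⟨k, hk⟩ := hgd r
  have hk0 : 0 ≤ k := (abs_nonneg _).trans (hk 0 0 (by simpa using hr))
  have hk₂ : 0 ≤ k₂ := (abs_nonneg _).trans (by simpa using hg 0 0)
  refine ⟨k₂ + k₁ * r, k * (max C' 0 * ρ), by positivity, by positivity,
    fun t u G hu hG => ⟨_, fun x hx => ?_, fun x z hxz => ?_, hG⟩⟩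
  all_goals
    have hKb : ∀ x ∈ Ω, |K Ω J u x| ≤ r := fun x hx =>
      (abs_K_le hpq hJm (le_max_right C 0) (hC0 x hx) (Lp.memLp u)).trans
        (mul_le_mul_of_nonneg_left (by rwa [← Lp.norm_def]) (le_max_right _ _))
  · refine (hg t _).trans ?_
    gcongr
    exact hKb x hx
  · have hgt : Differentiable ℝ (g t) :=
      (hgc.comp (contDiff_prodMk_right t)).differentiable one_ne_zero
    have h1 : |g t (K Ω J u x) - g t (K Ω J u z)| ≤ k * |K Ω J u x - K Ω J u z| :=
      Convex.norm_image_sub_le_of_norm_deriv_le (s := Icc (-r) r) (fun y _ => hgt y)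
        (fun y hy => hk t y (abs_le.2 hy)) (convex_Icc _ _)
        (abs_le.1 (hKb z (hxz (right_mem_segment ℝ x z))))
        (abs_le.1 (hKb x (hxz (left_mem_segment ℝ x z))))
    have h2 := slopeLE_K hpq hJm hΩ (fun x hx => ((hC0 x hx).trans_lt ENNReal.ofReal_lt_top).ne)
      hJd (le_max_right C' 0) hC'0 (Lp.stronglyMeasurable u) (Lp.memLp u) x z hxz
    rw [← Lp.norm_def] at h2
    calc _ ≤ k * |K Ω J u x - K Ω J u z| := h1
      _ ≤ k * (max C' 0 * ‖u‖ * ‖x - z‖) := by gcongr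
      _ ≤ k * (max C' 0 * ρ * ‖x - z‖) := by gcongr
      _ = _ := by ring

/-- The distance of a solution to a closed convex set that contains the values of the forcing term
decays exponentially. -/
theorem IsSolution.exists_mem_norm_sub_le [Fact (1 ≤ p)] {S : Set (X Ω p)} (hconv : Convex ℝ S)
    (hcl : IsClosed S) {τ t : ℝ} (hτt : τ < t) {u₀ : X Ω p} {u : ℝ → X Ω p}
    (hu : IsSolution Ω p J g τ u₀ u)
    (hS : ∀ s, τ ≤ s → ∀ G : X Ω p,
      G =ᵐ[volume.restrict Ω] (fun x => g s (K Ω J (u s) x)) → G ∈ S) :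
    ∃ c ∈ S, ‖u t - c‖ ≤ Real.exp (-(t - τ)) * (‖u₀‖ + ‖c‖) := by
  obtain ⟨G, hG⟩ := hu.exists_forcing
  obtain ⟨c, hc, hut⟩ := exists_mem_eq_exp_smul_add hconv hcl hτt
    (hu.continuousOn.mono Icc_subset_Ici_self)
    (fun s hs => (hG s hs.1.le).1.hasDerivAt (Ici_mem_nhds hs.1))
    (fun s hs => hS s hs.1.le _ (hG s hs.1.le).2)
  refine ⟨c, hc, ?_⟩
  have h : u t - c = Real.exp (-(t - τ)) • (u₀ - c) := by
    rw [hut, hu.initial]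
    module
  rw [h, norm_smul, Real.norm_eq_abs, Real.abs_exp]
  gcongr
  exact norm_sub_le _ _

end Dynamics

end NonlocalEvolution

theorem mainTheorem4 {N : ℕ} (Ω : Set (NonlocalEvolution.E N)) (hΩo : IsOpen Ω)
    (hΩb : Bornology.IsBounded Ω)
    (p q : ℝ≥0∞) [Fact (1 ≤ p)] (hpq : p.HolderConjugate q)
    -- the kernel: measurable, nonnegative, symmetric, normalized
    (J : NonlocalEvolution.E N → NonlocalEvolution.E N → ℝ)
    (hJm : Measurable (Function.uncurry J))
    (hJ0 : ∀ x y, 0 ≤ J x y)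
    (hJsymm : ∀ x y, J x y = J y x)
    (hJ1 : ∀ x, ∫ y, J x y = 1)
    -- `‖J(x,·)‖_{L^q(Ω)}` and `‖J_x(x,·)‖_{L^q(Ω)}` are bounded for `x ∈ Ω`
    (hJq : ∃ C : ℝ, ∀ x ∈ Ω, eLpNorm (J x) q (volume.restrict Ω) ≤ ENNReal.ofReal C)
    (hJd : ∀ x ∈ Ω, ∀ y ∈ Ω, DifferentiableAt ℝ (fun z => J z y) x)
    (hJxq : ∃ C : ℝ, ∀ x ∈ Ω,
      eLpNorm (fun y => fderiv ℝ (fun z => J z y) x) q (volume.restrict Ω) ≤ ENNReal.ofReal C)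
    -- the nonlinearity
    (g : ℝ → ℝ → ℝ)
    (hg : ContDiff ℝ 1 (Function.uncurry g))
    (hgrowth : ∃ k₁ k₂ : ℝ, k₁ < 1 ∧ ∀ t x, |g t x| ≤ k₂ + k₁ * |x|)
    (hgd : ∀ r : ℝ, ∃ k : ℝ, ∀ t x, |x| ≤ r → |deriv (g t) x| ≤ k)
    -- the pullback attractor of the generated process
    (A : ℝ → Set (NonlocalEvolution.X Ω p))
    (hA : NonlocalEvolution.IsPullbackAttractor (NonlocalEvolution.process Ω p J g) A) :
    ∃ B : Set (NonlocalEvolution.X Ω p),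
      NonlocalEvolution.IsBoundedInW1p Ω p B ∧ ∀ t : ℝ, A t ⊆ B := by
  have : IsFiniteMeasure (volume.restrict Ω) := ⟨by simpa using hΩb.measure_lt_top⟩
  obtain ⟨k₀, k₂, hk₀, hk⟩ := hgrowth
  -- Replacing the growth constant by its positive part makes it nonnegative.
  set k₁ := max k₀ 0
  have hk₁0 : 0 ≤ k₁ := le_max_right _ _
  have hk₁1 : k₁ < 1 := max_lt hk₀ one_pos
  have hk₁ : ∀ t x, |g t x| ≤ k₂ + k₁ * |x| := fun t x => (hk t x).trans (by
    gcongr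
    exact le_max_left _ _)
  set a := (eLpNorm (fun _ : NonlocalEvolution.E N => k₂) p (volume.restrict Ω)).toReal
  have ha : 0 ≤ a := ENNReal.toReal_nonneg
  -- Any radius above `a / (1 - k₁)` is absorbing.
  set R := (a + 1) / (1 - k₁)
  have hk₁' : 0 < 1 - k₁ := sub_pos.2 hk₁1
  have hR0 : 0 < R := by positivity
  have hR : a + k₁ * R < R := by
    have : (1 - k₁) * R = a + 1 := mul_div_cancel₀ _ hk₁'.ne'
    linarith
  have hproc : ∀ t τ w, τ ≤ t → ‖NonlocalEvolution.process Ω p J g t τ w‖ ≤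
      Real.exp (-((1 - k₁) * (t - τ))) * ‖w‖ + R := by
    intro t τ w hτ
    unfold NonlocalEvolution.process
    split_ifs with h
    · exact h.choose_spec.norm_le hJm hJ0 hJsymm hJ1 hk₁0 hk₁ hR0.le hR hτ
    · rw [norm_zero]
      positivity
  have hAR : ∀ t, ∀ w ∈ A t, ‖w‖ ≤ R := fun t w hw => by
    simpa using hA.minimal _ (fun _ => Metric.isClosed_closedBall)
      (NonlocalEvolution.pullbackAttracts_closedBall hR0 hk₁1 hproc) t hw
  obtain ⟨B, M, hB, hM, hG⟩ := NonlocalEvolution.exists_nonlinearity_mem_slopeBall (p := p) hpq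
    hΩo hJm hJq hJd hJxq hg hk₁0 hk₁ hgd (ρ := R + R) (by positivity)
  refine ⟨NonlocalEvolution.slopeBall Ω p B M,
    ⟨_, NonlocalEvolution.slopeBall_subset_sobolevBall hΩo hB hM⟩, fun t w hw => ?_⟩
  set R' := measureUnivNNReal (volume.restrict Ω) ^ p.toReal⁻¹ * B
  have hcl := NonlocalEvolution.isClosed_slopeBall (p := p) (B := B) (M := M) hΩo.measurableSet
  -- By invariance, `w` is the value at time `t` of solutions that start arbitrarily early in the
  -- ball of radius `R`. The default value `0` of the process lies in the slope ball as well, so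
  -- solvability of the Cauchy problem plays no role.
  have hdist : ∀ n : ℕ, ∃ c ∈ NonlocalEvolution.slopeBall Ω p B M,
      ‖w - c‖ ≤ Real.exp (-((n : ℝ) + 1)) * (R + R') := by
    intro n
    have ht : t - (n + 1) < t := by linarith [n.cast_nonneg' (α := ℝ)]
    obtain ⟨w₀, hw₀, rfl⟩ := (hA.invariant (t - (n + 1)) t ht.le).symm ▸ hw
    have hw₀R := hAR _ _ hw₀
    unfold NonlocalEvolution.process
    split_ifs with h
    · have hu := h.choose_spec
      set u := h.choose
      have hub : ∀ s, t - (n + 1) ≤ s → ‖u s‖ ≤ R + R := fun s hs => by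
        refine (hu.norm_le hJm hJ0 hJsymm hJ1 hk₁0 hk₁ hR0.le hR hs).trans ?_
        gcongr
        refine (mul_le_of_le_one_left (norm_nonneg _) (Real.exp_le_one_iff.2 ?_)).trans hw₀R
        exact neg_nonpos.2 (mul_nonneg hk₁'.le (sub_nonneg.2 hs))
      obtain ⟨c, hc, hle⟩ := hu.exists_mem_norm_sub_le NonlocalEvolution.convex_slopeBall hcl
        (t := t) ht (fun s hs G => hG s _ G (hub s hs))
      refine ⟨c, hc, hle.trans ?_⟩
      rw [sub_sub_cancel]
      gcongr
      exact NonlocalEvolution.norm_le_of_mem_slopeBall hΩo.measurableSet hB hc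
    · refine ⟨0, NonlocalEvolution.zero_mem_slopeBall hB hM, ?_⟩
      rw [sub_zero, norm_zero]
      positivity
  choose c hc hcw using hdist
  refine hcl.mem_of_tendsto (f := c) (b := atTop) ?_ (Eventually.of_forall hc)
  rw [tendsto_iff_norm_sub_tendsto_zero]
  refine squeeze_zero (fun _ => norm_nonneg _) (fun n => (norm_sub_rev _ _).trans_le (hcw n)) ?_
  have h1 : Tendsto (fun n : ℕ => -((n : ℝ) + 1)) atTop atBot :=
    tendsto_neg_atTop_atBot.comp (tendsto_atTop_add_const_right _ 1 tendsto_natCast_atTop_atTop)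
  simpa using (Real.tendsto_exp_atBot.comp h1).mul_const (R + R')
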